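/- All graphs are finite and simple. For $k\ge 2$, a graph $G$ is called $k$-leaf-connected if $|V(G)|\ge k+1$ and for every $S\subseteq V(G)$ with $|S|=k$ there is a spanning tree $T$ of $G$ such that $S$ is precisely the set of leaves (vertices of degree $1$) of $T$. For an integer $l\ge 0$, the $l$-closure $C_l(G)$ is the graph obtained from $G$ by successively joining pairs of nonadjacent vertices whose current degree sum is at least $l$, until no such pair exists (the result does not depend on the order). $G_1+G_2$ denotes disjoint union, $tK_1$ the edgeless graph on $t$ vertices, and $G_1\vee G_2$ the join, obtained from $G_1+G_2$ by adding all edges between $V(G_1)$ and $V(G_2)$. **Theorem.** Let $k\ge 2$ and let $G$ be a connected graph of order $n\ge k+17$ with minimum degree $\delta\ge k+1$. If $$e(G)\ge \binom{n-3}{2}+3k+5,$$ then $G$ is $k$-leaf-connected unless $C_{n+k-1}(G)$ is isomorphic to one of $$K_k\vee(K_{n-k-2}+K_2),\qquad K_3\vee(K_{n-5}+2K_1),\qquad K_4\vee(K_{n-7}+3K_1),$$ and in each of these exceptional cases $G$ is not $k$-leaf-connected. -/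

import Mathlib

namespace SimpleGraph

/-- The join `G ∨ H` of two vertex-disjoint graphs: their disjoint union together with all
edges between the two vertex sets. -/
def graphJoin {V W : Type*} (G : SimpleGraph V) (H : SimpleGraph W) : SimpleGraph (V ⊕ W) :=
  (G ⊕g H) ⊔ completeBipartiteGraph V W

/-- A graph is `k`-leaf-connected if it has at least `k + 1` vertices and, for every set `S` of
`k` vertices, it has a spanning tree whose set of leaves (vertices of degree one) is exactly `S`.
A spanning tree is a tree `T` on the whole vertex set all of whose edges are edges of `G`. -/
def IsLeafConnected {V : Type*} [Fintype V] (k : ℕ) (G : SimpleGraph V) : Prop :=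
  k + 1 ≤ Fintype.card V ∧
    ∀ S : Finset V, S.card = k →
      ∃ T : SimpleGraph V, T ≤ G ∧ T.IsTree ∧ ∀ v : V, v ∈ S ↔ (T.neighborSet v).ncard = 1

open Classical in
/-- `H` arises from `G` by joining one pair of distinct nonadjacent vertices whose degree sum
in `G` is at least `l`. -/
def JoinStep {V : Type*} [Fintype V] (l : ℕ) (G H : SimpleGraph V) : Prop :=
  ∃ u v : V, u ≠ v ∧ ¬ G.Adj u v ∧ l ≤ G.degree u + G.degree v ∧ H = G ⊔ edge u v

/-- `H` is obtained from `G` by successive joining steps, and no further step is possible. -/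
def IsDegreeClosure {V : Type*} [Fintype V] (l : ℕ) (G H : SimpleGraph V) : Prop :=
  Relation.ReflTransGen (JoinStep l) G H ∧ ∀ K : SimpleGraph V, ¬ JoinStep l H K

theorem JoinStep.lt {V : Type*} [Fintype V] {l : ℕ} {G H : SimpleGraph V}
    (h : JoinStep l G H) : G < H := by
  obtain ⟨u, v, huv, hadj, -, rfl⟩ := h
  refine lt_of_le_of_ne le_sup_left fun he => hadj ?_
  rw [he]
  exact Or.inr (by simp [edge_adj, huv])

theorem exists_isDegreeClosure {V : Type*} [Fintype V] (l : ℕ) (G : SimpleGraph V) :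
    ∃ H, IsDegreeClosure l G H := by
  classical
  induction G using WellFoundedGT.induction with
  | ind G ih =>
    by_cases h : ∃ K, JoinStep l G K
    · obtain ⟨K, hK⟩ := h
      obtain ⟨H, hH, hH'⟩ := ih K hK.lt
      exact ⟨H, hH.head hK, hH'⟩
    · exact ⟨G, .refl, not_exists.mp h⟩

theorem reflTransGen_joinStep_le {V : Type*} [Fintype V] {l : ℕ} {G H K : SimpleGraph V}
    (h : Relation.ReflTransGen (JoinStep l) G H) (hGK : G ≤ K)
    (hK : ∀ K', ¬ JoinStep l K K') : H ≤ K := by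
  classical
  induction h with
  | refl => exact hGK
  | tail _ hs ih =>
    obtain ⟨u, v, huv, -, hl, rfl⟩ := hs
    refine sup_le ih ?_
    have hadj : K.Adj u v := by
      by_contra hn
      refine hK _ ⟨u, v, huv, hn, hl.trans ?_, rfl⟩
      exact add_le_add (degree_le_of_le ih) (degree_le_of_le ih)
    intro a b hab
    rw [edge_adj] at hab
    obtain ⟨⟨rfl, rfl⟩ | ⟨rfl, rfl⟩, -⟩ := hab
    · exact hadj
    · exact hadj.symm

theorem reflTransGen_joinStep_ge {V : Type*} [Fintype V] {l : ℕ} {G H : SimpleGraph V}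
    (h : Relation.ReflTransGen (JoinStep l) G H) : G ≤ H := by
  induction h with
  | refl => exact le_rfl
  | tail _ hs ih => exact ih.trans hs.lt.le

/-- The result of the joining process does not depend on the order of the steps. -/
theorem IsDegreeClosure.unique {V : Type*} [Fintype V] {l : ℕ} {G H K : SimpleGraph V}
    (hH : IsDegreeClosure l G H) (hK : IsDegreeClosure l G K) : H = K :=
  le_antisymm (reflTransGen_joinStep_le hH.1 (reflTransGen_joinStep_ge hK.1) hK.2)
    (reflTransGen_joinStep_le hK.1 (reflTransGen_joinStep_ge hH.1) hH.2)

/-- The `l`-closure `C_l(G)`: the unique graph obtained from `G` by successively joining pairs of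
nonadjacent vertices whose degree sum is at least `l` until no such pair exists. -/
noncomputable def degreeClosure {V : Type*} [Fintype V] (l : ℕ) (G : SimpleGraph V) :
    SimpleGraph V :=
  (exists_isDegreeClosure l G).choose

theorem degreeClosure_spec {V : Type*} [Fintype V] (l : ℕ) (G : SimpleGraph V) :
    IsDegreeClosure l G (degreeClosure l G) :=
  (exists_isDegreeClosure l G).choose_spec

end SimpleGraph

/-! Joining two nonadjacent vertices of degree sum at least `n + k - 1` does not change
`k`-leaf-connectedness (`IsLeafConnected.of_sup_edge`), so `G` may be replaced by its closure `H`.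

In the complement `F` of `H`, with `N = n - k`, every edge has degree sum at least `N` because `H`
is closed, every degree is at most `N - 2` because of the minimum degree, and there are at most `3 *
N - 11` edges, as `n.choose 2 - (n - 3).choose 2 = 3 * n - 6`. So few edges with such large degree
sums must concentrate on two or three vertices: up to isolated vertices, `F` is empty, `K_{2,N-2}`,
`K₂ ∨ (N-3)K₁` or `K₃ ∨ (N-5)K₁` (`eq_bot_or_exists_of_degree_add_degree`).

Isolated vertices of `F` are universal in `H`. In the first nonempty case `H` is the first
exceptional graph. In the other two, `H` has `k + 1` or `k + 2` universal vertices, an independent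
set of 2 or 3 vertices and a clique. For `k ≥ 3` the universal vertices suffice to build the
spanning trees (`isLeafConnected_of_card_le`); for `k = 2` the other two exceptional graphs appear.

The exceptional graphs fail for two reasons: the leaves of a tree never separate its other vertices
(`not_isLeafConnected_of_separating`), and an independent set is too large for its neighbourhood
(`not_isLeafConnected_of_card_le`). -/

namespace SimpleGraph

/-! ### Rooted trees described by parent functions -/

/-- `p` is the parent function of the graph `T` rooted at `r`, with `d` strictly increasing
away from the root. -/
structure IsParentFun {V : Type*} (T : SimpleGraph V) (r : V) (p : V → V) (d : V → ℕ) : Prop where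
  root : p r = r
  lt : ∀ x, x ≠ r → d (p x) < d x
  adj : ∀ x y, T.Adj x y ↔ (x ≠ r ∧ p x = y) ∨ (y ≠ r ∧ p y = x)

namespace IsParentFun

variable {V : Type*} {T : SimpleGraph V} {r : V} {p : V → V} {d : V → ℕ}

theorem adj_parent (h : IsParentFun T r p d) {x : V} (hx : x ≠ r) : T.Adj x (p x) :=
  (h.adj _ _).2 (Or.inl ⟨hx, rfl⟩)

theorem reachable (h : IsParentFun T r p d) (x : V) : T.Reachable x r := by
  induction hn : d x using Nat.strong_induction_on generalizing x with
  | _ n ih =>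
    by_cases hx : x = r
    · rw [hx]
    · exact (h.adj_parent hx).reachable.trans (ih _ (hn ▸ h.lt x hx) _ rfl)

theorem connected (h : IsParentFun T r p d) : T.Connected :=
  { preconnected := fun x y => (h.reachable x).trans (h.reachable y).symm
    nonempty := ⟨r⟩ }

theorem edgeSet_eq (h : IsParentFun T r p d) :
    T.edgeSet = (fun x => s(x, p x)) '' {r}ᶜ := by
  ext e
  induction e with
  | _ x y =>
    rw [mem_edgeSet, h.adj]
    constructor
    · rintro (⟨hx, rfl⟩ | ⟨hy, rfl⟩)
      · exact ⟨x, hx, rfl⟩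
      · exact ⟨y, hy, Sym2.eq_swap⟩
    · rintro ⟨z, hz, he⟩
      rcases Sym2.eq_iff.1 he with ⟨rfl, rfl⟩ | ⟨rfl, rfl⟩
      · exact Or.inl ⟨hz, rfl⟩
      · exact Or.inr ⟨hz, rfl⟩

/-- Every edge is `x p(x)` for some `x ≠ r`, so this connected graph has at most `|V| - 1` edges. -/
theorem isTree [Finite V] (h : IsParentFun T r p d) : T.IsTree := by
  rw [isTree_iff_connected_and_card]
  refine ⟨h.connected, le_antisymm ?_ h.connected.card_vert_le_card_edgeSet_add_one⟩
  have h1 : Nat.card T.edgeSet ≤ ({r}ᶜ : Set V).ncard := by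
    rw [h.edgeSet_eq]
    exact Set.ncard_image_le (Set.toFinite _)
  have h2 := Set.ncard_add_ncard_compl ({r} : Set V)
  rw [Set.ncard_singleton] at h2
  omega

/-- A vertex which is a parent and is not the root has degree at least two. -/
theorem ncard_ne_one [Finite V] (h : IsParentFun T r p d) {x : V} (hx : x ≠ r) (hpx : p x ≠ r) :
    (T.neighborSet (p x)).ncard ≠ 1 := by
  intro h1
  obtain ⟨a, ha⟩ := Set.ncard_eq_one.1 h1
  have e1 : x ∈ T.neighborSet (p x) := (h.adj_parent hx).symm
  have e2 : p (p x) ∈ T.neighborSet (p x) := h.adj_parent hpx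
  rw [ha] at e1 e2
  have e3 : p (p x) = x := by rw [e2, e1]
  have h3 := h.lt x hx
  have h4 := h.lt _ hpx
  rw [e3] at h4
  omega

/-- A vertex other than the root which is not a leaf is a parent. -/
theorem exists_child (h : IsParentFun T r p d) {y : V} (hy : y ≠ r)
    (h1 : (T.neighborSet y).ncard ≠ 1) : ∃ x, x ≠ r ∧ p x = y := by
  by_contra! hc
  apply h1
  rw [Set.ncard_eq_one]
  refine ⟨p y, Set.ext fun z => ?_⟩
  rw [mem_neighborSet, h.adj, Set.mem_singleton_iff]
  constructor
  · rintro (⟨-, rfl⟩ | ⟨hz, he⟩)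
    · rfl
    · exact absurd he (hc z hz)
  · rintro rfl
    exact Or.inl ⟨hy, rfl⟩

theorem exists_child_root (h : IsParentFun T r p d) (hne : ∃ x, x ≠ r) :
    ∃ x, x ≠ r ∧ p x = r := by
  obtain ⟨x, hx⟩ := hne
  induction hn : d x using Nat.strong_induction_on generalizing x with
  | _ n ih =>
    by_cases hpx : p x = r
    · exact ⟨x, hx, hpx⟩
    · exact ih _ (hn ▸ h.lt x hx) _ hpx rfl

/-- If the root is not a leaf, it has a second child. -/
theorem exists_second_child (h : IsParentFun T r p d) (h1 : (T.neighborSet r).ncard ≠ 1) {a : V}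
    (ha : a ≠ r) (hpa : p a = r) : ∃ x, x ≠ r ∧ x ≠ a ∧ p x = r := by
  by_contra! hc
  apply h1
  rw [Set.ncard_eq_one]
  refine ⟨a, Set.ext fun z => ?_⟩
  rw [mem_neighborSet, h.adj, Set.mem_singleton_iff]
  constructor
  · rintro (⟨h2, -⟩ | ⟨hz, he⟩)
    · exact absurd rfl h2
    · by_contra hza
      exact hc z hz hza he
  · rintro rfl
    exact Or.inr ⟨ha, hpa⟩

end IsParentFun

/-- The parent of `x` is a neighbour closer to `r`. The edges `x p(x)` are distinct and number `|V|
- 1`, hence they are all the edges of the tree. -/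
theorem IsTree.exists_isParentFun {V : Type*} [Finite V] {T : SimpleGraph V} (hT : T.IsTree)
    (r : V) : ∃ p d, IsParentFun T r p d := by
  classical
  have hpar : ∀ x, x ≠ r → ∃ y, T.Adj x y ∧ T.dist y r < T.dist x r := by
    intro x hx
    obtain ⟨w, hw⟩ := hT.connected.exists_walk_length_eq_dist x r
    cases w with
    | nil => exact absurd rfl hx
    | cons hadj w' =>
      refine ⟨_, hadj, ?_⟩
      have := dist_le w'
      rw [Walk.length_cons] at hw
      omega
  choose! q hq using hpar
  let p : V → V := fun x => if x = r then r else q x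
  have hp : ∀ x, x ≠ r → p x = q x := fun x hx => if_neg hx
  have hlt : ∀ x, x ≠ r → T.dist (p x) r < T.dist x r := fun x hx => by
    rw [hp x hx]; exact (hq x hx).2
  have hadj : ∀ x, x ≠ r → T.Adj x (p x) := fun x hx => by
    rw [hp x hx]; exact (hq x hx).1
  refine ⟨p, fun x => T.dist x r, if_pos rfl, hlt, fun x y => ?_⟩
  constructor
  · intro hxy
    have hsub : (fun x => s(x, p x)) '' {r}ᶜ ⊆ T.edgeSet := by
      rintro _ ⟨z, hz, rfl⟩
      exact hadj z hz
    have hinj : Set.InjOn (fun x => s(x, p x)) {r}ᶜ := by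
      intro a ha b hb hab
      rcases Sym2.eq_iff.1 hab with ⟨h, -⟩ | ⟨h1, h2⟩
      · exact h
      · have h3 := hlt a ha
        have h4 := hlt b hb
        rw [h2] at h3
        rw [← h1] at h4
        omega
    have h1 := (isTree_iff_connected_and_card.1 hT).2
    have h2 := Set.ncard_add_ncard_compl ({r} : Set V)
    rw [Set.ncard_singleton] at h2
    have h3 := hinj.ncard_image
    have h4 : (fun x => s(x, p x)) '' {r}ᶜ = T.edgeSet := by
      refine Set.eq_of_subset_of_ncard_le hsub ?_ (Set.toFinite _)
      rw [h3]
      change Nat.card T.edgeSet ≤ _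
      omega
    have h5 : s(x, y) ∈ T.edgeSet := hxy
    rw [← h4] at h5
    obtain ⟨z, hz, he⟩ := h5
    rcases Sym2.eq_iff.1 he with ⟨rfl, rfl⟩ | ⟨rfl, rfl⟩
    · exact Or.inl ⟨hz, rfl⟩
    · exact Or.inr ⟨hz, rfl⟩
  · rintro (⟨hx, rfl⟩ | ⟨hy, rfl⟩)
    · exact hadj x hx
    · exact (hadj y hy).symm

/-! ### Edge exchange and stability under closure -/

/-- Exchange of two edges `uv`, `xy` of a tree for `vx`, `uy`. It keeps all degrees, and gives a
tree again if `v` and `y` lie in the same component after the removal of `uv` and `xy`. -/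
theorem IsTree.exchange {V : Type*} [Finite V] {T : SimpleGraph V} (hT : T.IsTree) {u v x y : V}
    (hne : u ≠ x ∧ u ≠ y ∧ v ≠ x ∧ v ≠ y) (huv : T.Adj u v) (hxy : T.Adj x y)
    (hr : (T.deleteEdges {s(u, v), s(x, y)}).Reachable v y)
    (hvx : ¬ T.Adj v x) (huy : ¬ T.Adj u y) :
    (T.deleteEdges {s(u, v), s(x, y)} ⊔ (edge v x ⊔ edge u y)).IsTree ∧
      ∀ z, ((T.deleteEdges {s(u, v), s(x, y)} ⊔ (edge v x ⊔ edge u y)).neighborSet z).ncard =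
        (T.neighborSet z).ncard := by
  classical
  obtain ⟨hux, huy', hvx', hvy'⟩ := hne
  have huv' := huv.ne
  have hxy' := hxy.ne
  set D := T.deleteEdges {s(u, v), s(x, y)} with hD
  set T' := D ⊔ (edge v x ⊔ edge u y) with hT'
  have hadj : ∀ a b, T'.Adj a b ↔ (T.Adj a b ∧ s(a, b) ≠ s(u, v) ∧ s(a, b) ≠ s(x, y)) ∨
      s(a, b) = s(v, x) ∨ s(a, b) = s(u, y) := by
    intro a b
    simp only [hT', hD, sup_adj, deleteEdges_adj, edge_adj, Set.mem_insert_iff,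
      Set.mem_singleton_iff, Sym2.eq_iff, not_or]
    grind
  have hDT : D ≤ T' := le_sup_left
  have hvyR : T'.Reachable v y := hr.mono hDT
  have e1 : T'.Adj v x := (hadj _ _).2 (by simp)
  have e2 : T'.Adj u y := (hadj _ _).2 (by simp)
  -- The ends of the deleted edges stay joined through the connection from `v` to `y`: `u, y, …, v`
  -- and `x, v, …, y`.
  have hstep : ∀ a b, T.Adj a b → T'.Reachable a b := by
    intro a b hab
    by_cases h1 : s(a, b) = s(u, v)
    · have := e2.reachable.trans hvyR.symm
      rcases Sym2.eq_iff.1 h1 with ⟨rfl, rfl⟩ | ⟨rfl, rfl⟩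
      · exact this
      · exact this.symm
    · by_cases h2 : s(a, b) = s(x, y)
      · have := e1.symm.reachable.trans hvyR
        rcases Sym2.eq_iff.1 h2 with ⟨rfl, rfl⟩ | ⟨rfl, rfl⟩
        · exact this
        · exact this.symm
      · exact ((hadj _ _).2 (Or.inl ⟨hab, h1, h2⟩)).reachable
  have hconn : T'.Connected := by
    have := hT.connected.nonempty
    refine { preconnected := fun a b => ?_ }
    obtain ⟨w⟩ := hT.connected.preconnected a b
    induction w with
    | nil => exact Reachable.refl _
    | cons h _ ih => exact (hstep _ _ h).trans ih
  refine ⟨?_, fun z => ?_⟩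
  · rw [isTree_iff_connected_and_card]
    refine ⟨hconn, le_antisymm ?_ hconn.card_vert_le_card_edgeSet_add_one⟩
    rw [← (isTree_iff_connected_and_card.1 hT).2]
    have hsub : T'.edgeSet ⊆
        insert s(v, x) (insert s(u, y) ((T.edgeSet \ {s(u, v)}) \ {s(x, y)})) := by
      intro e
      induction e with
      | _ a b =>
        rw [mem_edgeSet, hadj]
        rintro (⟨h1, h2, h3⟩ | h | h)
        · exact Or.inr (Or.inr ⟨⟨h1, h2⟩, h3⟩)
        · exact Or.inl h
        · exact Or.inr (Or.inl h)
    have h1 := Set.ncard_le_ncard hsub (Set.toFinite _)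
    have h2 := Set.ncard_insert_le s(v, x)
      (insert s(u, y) ((T.edgeSet \ {s(u, v)}) \ {s(x, y)}))
    have h3 := Set.ncard_insert_le s(u, y) ((T.edgeSet \ {s(u, v)}) \ {s(x, y)})
    have h4 : s(x, y) ∈ T.edgeSet \ {s(u, v)} := by
      refine ⟨hxy, fun h => ?_⟩
      rcases Sym2.eq_iff.1 h with ⟨rfl, rfl⟩ | ⟨rfl, rfl⟩
      · exact hux rfl
      · exact huy' rfl
    have h5 : s(u, v) ∈ T.edgeSet := huv
    have h6 := Set.ncard_sdiff_singleton_add_one h4 (Set.toFinite _)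
    have h7 := Set.ncard_sdiff_singleton_add_one h5 (Set.toFinite _)
    change T'.edgeSet.ncard + 1 ≤ T.edgeSet.ncard + 1
    omega
  -- At each of `u, v, x, y` exactly one neighbour is replaced by another; elsewhere nothing
  -- changes.
  · have key : ∀ {z a b : V}, a ∉ T.neighborSet z → b ∈ T.neighborSet z →
        (∀ w, T'.Adj z w ↔ w = a ∨ (T.Adj z w ∧ w ≠ b)) →
        (T'.neighborSet z).ncard = (T.neighborSet z).ncard := by
      intro z a b ha hb h
      rw [← Set.ncard_exchange ha hb]
      congr 1
      ext w
      simp [h]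
    have hvu := huv.symm
    have hyx := hxy.symm
    by_cases hzu : z = u
    · subst hzu
      refine key (a := y) (b := v) huy huv fun w => ?_
      rw [hadj]
      simp only [ne_eq, Sym2.eq_iff]
      grind
    by_cases hzv : z = v
    · subst hzv
      refine key (a := x) (b := u) hvx huv.symm fun w => ?_
      rw [hadj]
      simp only [ne_eq, Sym2.eq_iff]
      grind
    by_cases hzx : z = x
    · subst hzx
      refine key (a := v) (b := y) (fun h => hvx h.symm) hxy fun w => ?_
      rw [hadj]
      simp only [ne_eq, Sym2.eq_iff]
      grind
    by_cases hzy : z = y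
    · subst hzy
      refine key (a := u) (b := x) (fun h => huy h.symm) hxy.symm fun w => ?_
      rw [hadj]
      simp only [ne_eq, Sym2.eq_iff]
      grind
    congr 1
    ext w
    rw [mem_neighborSet, mem_neighborSet, hadj]
    simp only [ne_eq, Sym2.eq_iff]
    grind

theorem IsLeafConnected.mono {V : Type*} [Fintype V] {k : ℕ} {G H : SimpleGraph V} (hGH : G ≤ H)
    (hG : G.IsLeafConnected k) : H.IsLeafConnected k := by
  refine ⟨hG.1, fun S hS => ?_⟩
  obtain ⟨T, hT, h⟩ := hG.2 S hS
  exact ⟨T, hT.trans hGH, h⟩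

-- If a tree `T` with leaf set `S` uses the new edge `uv`, an exchange removes it without changing
-- any degree. A tree edge `x p(x)` serves as partner if `x` is a `G`-neighbour of the end of `uv`
-- on its own side of `T - uv` and `p x` is one of the opposite end. Such an `x` exists by counting:
-- at least `deg u + deg v - k ≥ n - 1` incidences fall on the `n - 2` vertices other than `u, v`,
-- the loss `k` being due to leaves, which have no child.
open Classical in
theorem IsLeafConnected.of_sup_edge {V : Type*} [Fintype V] {k : ℕ} {G : SimpleGraph V} {u v : V}
    (huv : u ≠ v) (hnadj : ¬ G.Adj u v)
    (hdeg : Fintype.card V + k - 1 ≤ G.degree u + G.degree v)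
    (hG : (G ⊔ edge u v).IsLeafConnected k) : G.IsLeafConnected k := by
  refine ⟨hG.1, fun S hS => ?_⟩
  obtain ⟨T, hTG, hT, hleaf⟩ := hG.2 S hS
  have hTG' : ∀ a b, T.Adj a b → s(a, b) ≠ s(u, v) → G.Adj a b := by
    intro a b hab hne
    have h := hTG hab
    rw [sup_adj, edge_adj] at h
    rcases h with h | ⟨⟨rfl, rfl⟩ | ⟨rfl, rfl⟩, -⟩
    · exact h
    · exact absurd rfl hne
    · exact absurd Sym2.eq_swap hne
  by_cases hTuv : T.Adj u v
  swap
  · refine ⟨T, fun a b hab => hTG' a b hab fun he => hTuv ?_, hT, hleaf⟩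
    rw [← mem_edgeSet, ← he]
    exact hab
  obtain ⟨p, d, hp⟩ := hT.exists_isParentFun u
  have hpv : p v = u := by
    rcases (hp.adj u v).1 hTuv with ⟨h, -⟩ | ⟨-, h⟩
    · exact absurd rfl h
    · exact h
  -- The subtree below `v`, that is, the side of `v` in `T - uv` for the tree rooted at `u`.
  let s : V → Prop := fun x => ∃ j, p^[j] x = v
  have hsv : s v := ⟨0, rfl⟩
  have hsu : ¬ s u := by
    rintro ⟨j, hj⟩
    rw [Function.iterate_fixed hp.root] at hj
    exact huv hj
  have hsp : ∀ x, x ≠ v → (s x ↔ s (p x)) := by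
    intro x hx
    constructor
    · rintro ⟨j, hj⟩
      cases j with
      | zero => exact absurd hj hx
      | succ j => exact ⟨j, by rwa [Function.iterate_succ_apply] at hj⟩
    · rintro ⟨j, hj⟩
      exact ⟨j + 1, by rwa [Function.iterate_succ_apply]⟩
  let own : V → V := fun x => if s x then v else u
  let opp : V → V := fun x => if s x then u else v
  have hown1 : ∀ x, s x → own x = v := fun x hx => if_pos hx
  have hown2 : ∀ x, ¬ s x → own x = u := fun x hx => if_neg hx
  have hopp1 : ∀ x, s x → opp x = u := fun x hx => if_pos hx
  have hopp2 : ∀ x, ¬ s x → opp x = v := fun x hx => if_neg hx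
  let A : Finset V := Finset.univ.filter fun x => G.Adj (own x) x
  let C : Finset V := Finset.univ.filter fun x => G.Adj (opp x) x
  let B : Finset V := Finset.univ.filter fun x => x ≠ u ∧ x ≠ v ∧ p x ∈ C
  -- For every `x`, the vertices `own x` and `opp x` are `u` and `v` in some order.
  have hAC : A.card + C.card = G.degree u + G.degree v := by
    rw [← card_neighborFinset_eq_degree, ← card_neighborFinset_eq_degree,
      neighborFinset_eq_filter, neighborFinset_eq_filter]
    simp only [A, C, Finset.card_filter]
    rw [← Finset.sum_add_distrib, ← Finset.sum_add_distrib]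
    refine Finset.sum_congr rfl fun x _ => ?_
    by_cases hx : s x
    · rw [hown1 x hx, hopp1 x hx, add_comm]
    · rw [hown2 x hx, hopp2 x hx]
  have hA : ∀ x ∈ A, x ≠ u ∧ x ≠ v := by
    intro x hx
    have hx' : G.Adj (own x) x := (Finset.mem_filter.1 hx).2
    refine ⟨?_, ?_⟩ <;> rintro rfl
    · rw [hown2 _ hsu] at hx'; exact hx'.ne rfl
    · rw [hown1 _ hsv] at hx'; exact hx'.ne rfl
  have hC : ∀ x ∈ C, x ≠ u ∧ x ≠ v := by
    intro x hx
    have hx' : G.Adj (opp x) x := (Finset.mem_filter.1 hx).2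
    refine ⟨?_, ?_⟩ <;> rintro rfl
    · rw [hopp2 _ hsu] at hx'; exact hnadj hx'.symm
    · rw [hopp1 _ hsv] at hx'; exact hnadj hx'
  have hBC : C \ S ⊆ B.image p := by
    intro y hy
    obtain ⟨hyC, hyS⟩ := Finset.mem_sdiff.1 hy
    obtain ⟨x, hxu, hxy⟩ := hp.exists_child (hC y hyC).1 (fun h => hyS ((hleaf y).2 h))
    refine Finset.mem_image.2 ⟨x, Finset.mem_filter.2 ⟨Finset.mem_univ _, hxu, ?_, ?_⟩, hxy⟩
    · rintro rfl
      exact (hC y hyC).1 (hxy.symm.trans hpv)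
    · rwa [hxy]
  have hBcard : C.card ≤ B.card + k := by
    have h1 := (Finset.card_le_card hBC).trans Finset.card_image_le
    have h2 := Finset.le_card_sdiff S C
    omega
  have hAB : (A ∩ B).Nonempty := by
    rw [← Finset.card_pos]
    have h1 := Finset.card_union_add_card_inter A B
    have h2 : (A ∪ B).card ≤ (({u, v} : Finset V)ᶜ).card := by
      refine Finset.card_le_card fun x hx => ?_
      rw [Finset.mem_compl, Finset.mem_insert, Finset.mem_singleton, not_or]
      rcases Finset.mem_union.1 hx with h | h
      · exact hA x h
      · exact ⟨(Finset.mem_filter.1 h).2.1, (Finset.mem_filter.1 h).2.2.1⟩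
    rw [Finset.card_compl, Finset.card_pair huv] at h2
    have h3 : 1 < Fintype.card V := Fintype.one_lt_card_iff.2 ⟨u, v, huv⟩
    omega
  obtain ⟨x, hx⟩ := hAB
  obtain ⟨hxA, hxB⟩ := Finset.mem_inter.1 hx
  obtain ⟨-, hxu, hxv, hyC⟩ := Finset.mem_filter.1 hxB
  obtain ⟨hyu, hyv⟩ := hC _ hyC
  have hGx : G.Adj (own x) x := (Finset.mem_filter.1 hxA).2
  have hGy : G.Adj (opp (p x)) (p x) := (Finset.mem_filter.1 hyC).2
  have hxy := hp.adj_parent hxu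
  -- Climbing from a vertex with smaller `d` than `x` never meets the edge `x p(x)`, and ends at `u`
  -- or `v` before using `uv`.
  have hreach : ∀ m z, d z = m → d z < d x →
      (T.deleteEdges {s(u, v), s(x, p x)}).Reachable z (own z) := by
    intro m
    induction m using Nat.strong_induction_on with
    | _ m ih =>
      intro z hm hz
      by_cases hzu : z = u
      · rw [hzu, hown2 _ hsu]
      by_cases hzv : z = v
      · rw [hzv, hown1 _ hsv]
      have hlt := hp.lt z hzu
      have h1 := ih _ (hm ▸ hlt) (p z) rfl (hlt.trans hz)
      have h2 : own (p z) = own z := by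
        by_cases h : s z
        · rw [hown1 _ h, hown1 _ ((hsp z hzv).1 h)]
        · rw [hown2 _ h, hown2 _ (fun h' => h ((hsp z hzv).2 h'))]
      rw [h2] at h1
      refine Reachable.trans (Adj.reachable ?_) h1
      rw [deleteEdges_adj]
      refine ⟨hp.adj_parent hzu, ?_⟩
      rintro (h | h)
      · rcases Sym2.eq_iff.1 h with ⟨h, -⟩ | ⟨h, -⟩
        · exact hzu h
        · exact hzv h
      · rcases Sym2.eq_iff.1 h with ⟨h, -⟩ | ⟨-, h⟩
        · rw [h] at hz; exact lt_irrefl _ hz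
        · rw [h] at hlt; exact lt_asymm hlt hz
  have hry := hreach _ (p x) rfl (hp.lt x hxu)
  by_cases hs : s x
  · have hsy := (hsp x hxv).1 hs
    rw [hown1 _ hs] at hGx
    rw [hopp1 _ hsy] at hGy
    rw [hown1 _ hsy] at hry
    have hvx : ¬ T.Adj v x := by
      rw [hp.adj]
      rintro (⟨-, h⟩ | ⟨-, h⟩)
      · exact hxu (h.symm.trans hpv)
      · exact hyv h
    have huy : ¬ T.Adj u (p x) := by
      rw [hp.adj]
      rintro (⟨h, -⟩ | ⟨-, h⟩)
      · exact h rfl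
      · exact hsu (h ▸ (hsp _ hyv).1 hsy)
    obtain ⟨h1, h2⟩ := hT.exchange ⟨hxu.symm, hyu.symm, hxv.symm, hyv.symm⟩ hTuv hxy hry.symm hvx huy
    refine ⟨_, ?_, h1, fun z => by rw [h2]; exact hleaf z⟩
    refine sup_le (fun a b hab => ?_) (sup_le ?_ ?_)
    · rw [deleteEdges_adj] at hab
      exact hTG' a b hab.1 fun h => hab.2 (Or.inl h)
    · rwa [edge_le_iff, or_iff_right hxv.symm]
    · rwa [edge_le_iff, or_iff_right hyu.symm]
  · have hsy : ¬ s (p x) := fun h => hs ((hsp x hxv).2 h)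
    rw [hown2 _ hs] at hGx
    rw [hopp2 _ hsy] at hGy
    rw [hown2 _ hsy, Sym2.eq_swap] at hry
    have hux : ¬ T.Adj u x := by
      rw [hp.adj]
      rintro (⟨h, -⟩ | ⟨-, h⟩)
      · exact h rfl
      · exact hyu h
    have hvy : ¬ T.Adj v (p x) := by
      rw [hp.adj]
      rintro (⟨-, h⟩ | ⟨-, h⟩)
      · exact hyu (h.symm.trans hpv)
      · exact hsy ((hsp _ hyv).2 (h ▸ hsv))
    obtain ⟨h1, h2⟩ :=
      hT.exchange ⟨hxv.symm, hyv.symm, hxu.symm, hyu.symm⟩ hTuv.symm hxy hry.symm hux hvy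
    refine ⟨_, ?_, h1, fun z => by rw [h2]; exact hleaf z⟩
    refine sup_le (fun a b hab => ?_) (sup_le ?_ ?_)
    · rw [deleteEdges_adj] at hab
      exact hTG' a b hab.1 fun h => hab.2 (Or.inl (h.trans Sym2.eq_swap))
    · rwa [edge_le_iff, or_iff_right hxu.symm]
    · rwa [edge_le_iff, or_iff_right hyv.symm]

theorem IsLeafConnected.of_reflTransGen_joinStep {V : Type*} [Fintype V] {k : ℕ}
    {G H : SimpleGraph V} (h : Relation.ReflTransGen (JoinStep (Fintype.card V + k - 1)) G H)
    (hH : H.IsLeafConnected k) : G.IsLeafConnected k := by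
  induction h with
  | refl => exact hH
  | tail _ hs ih =>
    obtain ⟨u, v, huv, hadj, hl, rfl⟩ := hs
    exact ih (hH.of_sup_edge huv hadj hl)

theorem isLeafConnected_degreeClosure_iff {V : Type*} [Fintype V] {k : ℕ} {G : SimpleGraph V} :
    (G.degreeClosure (Fintype.card V + k - 1)).IsLeafConnected k ↔ G.IsLeafConnected k :=
  ⟨.of_reflTransGen_joinStep (degreeClosure_spec _ G).1,
    .mono (reflTransGen_joinStep_ge (degreeClosure_spec _ G).1)⟩

/-! ### Spanning trees from systems of paths -/

/-- `ChainSystem G S P Q` says that `P` is partitioned into paths of `G`, each of which has exactly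
one vertex in `S`, namely its last one; `Q` is the set of the first vertices of the paths. -/
inductive ChainSystem {V : Type*} [DecidableEq V] (G : SimpleGraph V) (S : Finset V) :
    Finset V → Finset V → Prop
  | base : ChainSystem G S S S
  | step {P Q : Finset V} {y h : V} (hPQ : ChainSystem G S P Q) (hy : y ∉ P) (hh : h ∈ Q)
      (hadj : G.Adj y h) : ChainSystem G S (insert y P) (insert y (Q.erase h))

namespace ChainSystem

variable {V : Type*} [DecidableEq V] {G : SimpleGraph V} {S P Q : Finset V}

theorem subset (h : ChainSystem G S P Q) : S ⊆ P := by
  induction h with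
  | base => exact subset_rfl
  | step _ _ _ _ ih => exact ih.trans (Finset.subset_insert _ _)

theorem heads_subset (h : ChainSystem G S P Q) : Q ⊆ P := by
  induction h with
  | base => exact subset_rfl
  | step _ _ _ _ ih => exact Finset.insert_subset_insert _ ((Finset.erase_subset _ _).trans ih)

theorem card_heads (h : ChainSystem G S P Q) : Q.card = S.card := by
  induction h with
  | base => rfl
  | @step P Q y h hPQ hy hh _ ih =>
    rw [Finset.card_insert_of_notMem
      (fun h' => hy (hPQ.heads_subset (Finset.mem_of_mem_erase h'))), Finset.card_erase_of_mem hh]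
    have := Finset.card_pos.2 ⟨h, hh⟩
    omega

/-- The paths of a chain system, as a function sending every vertex to its predecessor. -/
theorem exists_parent (h : ChainSystem G S P Q) : ∃ (p : V → V) (d : V → ℕ),
    (∀ x ∈ P, x ∉ Q → p x ∈ P ∧ p x ∉ S ∧ G.Adj x (p x) ∧ d (p x) < d x) ∧
      ∀ y ∈ P, y ∉ S → ∃ x ∈ P, x ∉ Q ∧ p x = y := by
  induction h with
  | base => exact ⟨id, fun _ => 0, fun x h1 h2 => absurd h1 h2, fun x h1 h2 => absurd h1 h2⟩
  | @step P Q y h hPQ hy hh hadj ih =>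
    obtain ⟨p, d, h1, h2⟩ := ih
    have hhP := hPQ.heads_subset hh
    have hyh : h ≠ y := fun e => hy (e ▸ hhP)
    -- The old first vertex `h` gets the predecessor `y`; the new first vertex has depth 0, so all
    -- other depths are shifted by one.
    refine ⟨Function.update p h y, fun z => if z = y then 0 else d z + 1, ?_, ?_⟩
    · intro x hx hxQ
      rw [Finset.mem_insert, Finset.mem_erase, not_or, not_and'] at hxQ
      obtain ⟨hxy, hxQ⟩ := hxQ
      have hxP := Finset.mem_of_mem_insert_of_ne hx hxy
      by_cases hxh : x = h
      · subst hxh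
        rw [Function.update_self]
        refine ⟨Finset.mem_insert_self _ _, fun h' => hy (hPQ.subset h'), hadj.symm, ?_⟩
        simp [hxy]
      · rw [Function.update_of_ne hxh]
        obtain ⟨a1, a2, a3, a4⟩ := h1 x hxP (fun h' => hxQ h' hxh)
        have hpy : p x ≠ y := fun e => hy (e ▸ a1)
        refine ⟨Finset.mem_insert_of_mem a1, a2, a3, ?_⟩
        simp [hxy, hpy, a4]
    · intro z hz hzS
      rcases Finset.mem_insert.1 hz with rfl | hz
      · refine ⟨h, Finset.mem_insert_of_mem hhP, ?_, Function.update_self ..⟩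
        simp [hyh]
      · obtain ⟨x, hx, hxQ, hxz⟩ := h2 z hz hzS
        have hxh : x ≠ h := fun e => hxQ (e ▸ hh)
        have hxy : x ≠ y := fun e => hy (e ▸ hx)
        refine ⟨x, Finset.mem_insert_of_mem hx, ?_, ?_⟩
        · simp [hxy, hxQ]
        · rw [Function.update_of_ne hxh, hxz]

/-- A chain system covering everything except a universal vertex `r` gives a spanning tree with
leaf set `S`: all the paths are attached to `r`. -/
theorem exists_isTree [Fintype V] {r : V} (h : ChainSystem G S (Finset.univ.erase r) Q)
    (hr : ∀ x, x ≠ r → G.Adj x r) (hS : 2 ≤ S.card) :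
    ∃ T : SimpleGraph V, T ≤ G ∧ T.IsTree ∧ ∀ v : V, v ∈ S ↔ (T.neighborSet v).ncard = 1 := by
  obtain ⟨q, e, h1, h2⟩ := h.exists_parent
  have hP : ∀ x, x ∈ Finset.univ.erase r ↔ x ≠ r := by simp
  simp only [hP] at h1 h2
  have hrS : r ∉ S := fun h' => (hP r).1 (h.subset h') rfl
  have hrQ : r ∉ Q := fun h' => (hP r).1 (h.heads_subset h') rfl
  let p : V → V := fun x => if x = r ∨ x ∈ Q then r else q x
  let d : V → ℕ := fun x => if x = r then 0 else e x + 1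
  have hpr : p r = r := if_pos (Or.inl rfl)
  have hpQ : ∀ x ∈ Q, p x = r := fun x hx => if_pos (Or.inr hx)
  have hpn : ∀ x, x ≠ r → x ∉ Q → p x = q x := fun x h1 h2 => if_neg (by tauto)
  have hdr : d r = 0 := if_pos rfl
  have hdn : ∀ x, x ≠ r → d x = e x + 1 := fun x hx => if_neg hx
  have hlt : ∀ x, x ≠ r → d (p x) < d x := by
    intro x hx
    by_cases hxQ : x ∈ Q
    · rw [hpQ x hxQ, hdr, hdn x hx]; omega
    · obtain ⟨a1, -, -, a4⟩ := h1 x hx hxQ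
      rw [hpn x hx hxQ, hdn x hx, hdn _ a1]; omega
  have hne : ∀ x, x ≠ r → p x ≠ x := fun x hx he => by
    have := hlt x hx
    rw [he] at this
    exact lt_irrefl _ this
  let T : SimpleGraph V :=
    { Adj := fun x y => (x ≠ r ∧ p x = y) ∨ (y ≠ r ∧ p y = x)
      symm := ⟨fun x y h => h.symm⟩
      loopless := ⟨fun x h => by
        rcases h with ⟨h, he⟩ | ⟨h, he⟩ <;> exact hne x h he⟩ }
  have hT : IsParentFun T r p d := ⟨hpr, hlt, fun _ _ => Iff.rfl⟩
  have hpadj : ∀ x, x ≠ r → G.Adj x (p x) := by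
    intro x hx
    by_cases hxQ : x ∈ Q
    · rw [hpQ x hxQ]; exact hr x hx
    · rw [hpn x hx hxQ]; exact (h1 x hx hxQ).2.2.1
  refine ⟨T, ?_, hT.isTree, fun v => ⟨fun hv => ?_, fun hv => ?_⟩⟩
  · rintro a b (⟨ha, rfl⟩ | ⟨hb, rfl⟩)
    · exact hpadj a ha
    · exact (hpadj b hb).symm
  · by_contra hc
    have hvr : v ≠ r := fun e => hrS (e ▸ hv)
    obtain ⟨x, hx, hxv⟩ := hT.exists_child hvr hc
    by_cases hxQ : x ∈ Q
    · exact hvr (hxv.symm.trans (hpQ x hxQ))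
    · rw [hpn x hx hxQ] at hxv
      exact (h1 x hx hxQ).2.1 (hxv ▸ hv)
  · by_contra hvS
    -- The root is not a leaf: all first vertices are its children, and there are `S.card ≥ 2` of
    -- them.
    by_cases hvr : v = r
    · subst hvr
      obtain ⟨a, ha, b, hb, hab⟩ := Finset.one_lt_card.1 (h.card_heads ▸ hS : 1 < Q.card)
      obtain ⟨c, hc⟩ := Set.ncard_eq_one.1 hv
      have hmem : ∀ x ∈ Q, x = c := by
        intro x hx
        have : x ∈ T.neighborSet v := Or.inr ⟨fun e => hrQ (e ▸ hx), hpQ x hx⟩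
        rwa [hc] at this
      exact hab ((hmem a ha).trans (hmem b hb).symm)
    · obtain ⟨x, hx, hxQ, hxv⟩ := h2 v hvr hvS
      have hpv : p x = v := (hpn x hx hxQ).trans hxv
      exact hT.ncard_ne_one hx (hpv ▸ hvr) (hpv ▸ hv)

/-- Once `I` is covered, the uncovered vertices other than `r` lie in the clique and can be
prepended one after another to the path whose first vertex is outside `I`. -/
theorem exists_of_head_notMem [Fintype V] {I : Finset V} {r : V} (h : ChainSystem G S P Q)
    (hrP : r ∉ P) (hIP : I ⊆ P) (hQ : ∃ a ∈ Q, a ∉ I)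
    (hclique : ∀ a b, a ∉ I → b ∉ I → a ≠ b → G.Adj a b) :
    ∃ Q', ChainSystem G S (Finset.univ.erase r) Q' := by
  induction hm : Pᶜ.card using Nat.strong_induction_on generalizing P Q with
  | _ m ih =>
    by_cases hc : ∃ c, c ≠ r ∧ c ∉ P
    · obtain ⟨c, hcr, hcP⟩ := hc
      obtain ⟨a, haQ, haI⟩ := hQ
      have hcI : c ∉ I := fun h' => hcP (hIP h')
      have hca : c ≠ a := fun e => hcP (e ▸ h.heads_subset haQ)
      refine ih _ ?_ (h.step hcP haQ (hclique c a hcI haI hca)) ?_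
        (hIP.trans (Finset.subset_insert _ _)) ⟨c, Finset.mem_insert_self _ _, hcI⟩ rfl
      · rw [← hm]
        exact Finset.card_lt_card (Finset.compl_ssubset_compl.2 (Finset.ssubset_insert hcP))
      · simp [hcr.symm, hrP]
    · push Not at hc
      have : P = Finset.univ.erase r := by
        ext x
        simp only [Finset.mem_erase, Finset.mem_univ, and_true]
        exact ⟨fun hx e => hrP (e ▸ hx), hc x⟩
      exact ⟨Q, this ▸ h⟩

/-- A vertex of `I` can always be prepended to a path starting in `W`; this lowers both sides of
`hcard` by one. If no path starts in `W`, an uncovered vertex of `W` is prepended to any path, and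
the right side does not drop. The summand 1 leaves a path starting in `W`, hence outside `I`, when
`I` is used up. -/
theorem exists_of_card_le [Fintype V] {W I : Finset V} {r : V} (h : ChainSystem G S P Q)
    (hrP : r ∉ P) (hrW : r ∈ W) (hWI : Disjoint W I) (hS : S.Nonempty)
    (hclique : ∀ a b, a ∉ I → b ∉ I → a ≠ b → G.Adj a b)
    (hW : ∀ w ∈ W, ∀ x, x ≠ w → G.Adj w x)
    (hcard : (I \ P).card + 1 ≤ (Q ∩ W).card + (W.erase r \ P).card) :
    ∃ Q', ChainSystem G S (Finset.univ.erase r) Q' := by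
  induction hm : Pᶜ.card using Nat.strong_induction_on generalizing P Q with
  | _ m ih =>
    have hlt : ∀ y, y ∉ P → (insert y P)ᶜ.card < m := fun y hy => by
      rw [← hm]
      exact Finset.card_lt_card (Finset.compl_ssubset_compl.2 (Finset.ssubset_insert hy))
    by_cases hQW : (Q ∩ W).Nonempty
    · obtain ⟨a, ha⟩ := hQW
      obtain ⟨haQ, haW⟩ := Finset.mem_inter.1 ha
      by_cases hI : (I \ P).Nonempty
      · obtain ⟨i, hi⟩ := hI
        obtain ⟨hiI, hiP⟩ := Finset.mem_sdiff.1 hi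
        have hia : i ≠ a := fun e => hiP (e ▸ h.heads_subset haQ)
        have hir : r ≠ i := fun e => Finset.disjoint_left.1 hWI hrW (e ▸ hiI)
        refine ih _ (hlt i hiP) (h.step hiP haQ (hW a haW i hia).symm) ?_ ?_ rfl
        · simp [hir, hrP]
        · have hiW : i ∉ W := fun h' => Finset.disjoint_left.1 hWI h' hiI
          have e1 : I \ insert i P = (I \ P).erase i := by ext; simp; tauto
          have e2 : W.erase r \ insert i P = W.erase r \ P := by
            ext x
            simp only [Finset.mem_sdiff, Finset.mem_erase, Finset.mem_insert]
            constructor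
            · tauto
            · rintro ⟨⟨h1, h2⟩, h3⟩
              exact ⟨⟨h1, h2⟩, fun h' => h'.elim (fun e => hiW (e ▸ h2)) h3⟩
          have e3 : (Q ∩ W).erase a ⊆ insert i (Q.erase a) ∩ W := by
            intro x; simp; tauto
          have e4 := Finset.card_le_card e3
          rw [Finset.card_erase_of_mem ha] at e4
          rw [e1, e2, Finset.card_erase_of_mem hi]
          have := Finset.card_pos.2 ⟨i, hi⟩
          omega
      · rw [Finset.not_nonempty_iff_eq_empty, Finset.sdiff_eq_empty_iff_subset] at hI
        exact h.exists_of_head_notMem hrP hI ⟨a, haQ, Finset.disjoint_left.1 hWI haW⟩ hclique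
    · rw [Finset.not_nonempty_iff_eq_empty] at hQW
      rw [hQW, Finset.card_empty] at hcard
      obtain ⟨w, hw⟩ := Finset.card_pos.1 (show 0 < (W.erase r \ P).card by omega)
      obtain ⟨hwW, hwP⟩ := Finset.mem_sdiff.1 hw
      obtain ⟨hwr, hwW⟩ := Finset.mem_erase.1 hwW
      obtain ⟨a, haQ⟩ := Finset.card_pos.1 (h.card_heads ▸ Finset.card_pos.2 hS : 0 < Q.card)
      have hwa : a ≠ w := fun e => hwP (e ▸ h.heads_subset haQ)
      refine ih _ (hlt w hwP) (h.step hwP haQ (hW w hwW a hwa)) ?_ ?_ rfl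
      · simp [hwr.symm, hrP]
      · have hwI : w ∉ I := Finset.disjoint_left.1 hWI hwW
        have e1 : I \ insert w P ⊆ I \ P := by intro x; simp; tauto
        have e2 : W.erase r \ insert w P = (W.erase r \ P).erase w := by ext; simp; tauto
        have e3 : 0 < (insert w (Q.erase a) ∩ W).card :=
          Finset.card_pos.2 ⟨w, by simp [hwW]⟩
        have e4 := Finset.card_le_card e1
        rw [e2, Finset.card_erase_of_mem hw]
        have := Finset.card_pos.2 ⟨w, hw⟩
        omega

end ChainSystem

/-- A graph consisting of a set `I` of arbitrary vertices, a set `W` of universal vertices, and a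
clique on the remaining vertices is `k`-leaf-connected if `W` is large enough. -/
theorem isLeafConnected_of_card_le {V : Type*} [Fintype V] {k : ℕ} {G : SimpleGraph V}
    (hk : 2 ≤ k) {W I : Finset V} (hWI : Disjoint W I)
    (hclique : ∀ a b, a ∉ I → b ∉ I → a ≠ b → G.Adj a b)
    (hW : ∀ w ∈ W, ∀ x, x ≠ w → G.Adj w x) (hkW : k + 1 ≤ W.card) (hIW : I.card + 2 ≤ W.card) :
    G.IsLeafConnected k := by
  classical
  refine ⟨hkW.trans (Finset.card_le_univ _), fun S hS => ?_⟩
  -- The root is a universal vertex outside `S`. Setting it aside costs one vertex of `W`, which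
  -- together with the 1 in `exists_of_card_le` explains the 2 in `hIW`.
  obtain ⟨r, hrW, hrS⟩ := Finset.exists_mem_notMem_of_card_lt_card (show S.card < W.card by omega)
  have hSn : S.Nonempty := Finset.card_pos.1 (by omega)
  obtain ⟨Q, hQ⟩ := ChainSystem.exists_of_card_le (ChainSystem.base (G := G) (S := S)) hrS hrW hWI
    hSn hclique hW (by
      have h1 := Finset.card_le_card (Finset.sdiff_subset : I \ S ⊆ I)
      have h2 := Finset.card_inter_add_card_sdiff (W.erase r) S
      have h3 : W.erase r ∩ S ⊆ S ∩ W := by intro x; simp; tauto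
      have h4 := Finset.card_le_card h3
      have h5 := Finset.card_erase_of_mem hrW
      omega)
  exact hQ.exists_isTree (fun x hx => (hW r hrW x hx).symm) (by omega)

/-! ### Obstructions to leaf-connectedness -/

/-- If removing `k` vertices disconnects the graph, then it is not `k`-leaf-connected. -/
theorem not_isLeafConnected_of_separating {V : Type*} [Fintype V] {k : ℕ} {G : SimpleGraph V}
    {W A : Finset V} (hW : W.card = k) {a b : V} (haW : a ∉ W) (haA : a ∈ A) (hbW : b ∉ W)
    (hbA : b ∉ A) (hsep : ∀ x ∈ A, ∀ y ∉ A, x ∉ W → y ∉ W → ¬ G.Adj x y) :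
    ¬ G.IsLeafConnected k := by
  intro hG
  obtain ⟨T, hTG, hT, hleaf⟩ := hG.2 W hW
  obtain ⟨p, d, hp⟩ := hT.exists_isParentFun a
  -- With `W` as leaf set, the climb from a vertex outside `W` to the root `a` avoids `W`, since
  -- parents other than the root are not leaves; so it cannot cross between the two sides.
  have key : ∀ m x, d x = m → x ∉ W → x ∈ A := by
    intro m
    induction m using Nat.strong_induction_on with
    | _ m ih =>
      intro x hm hxW
      by_cases hxa : x = a
      · exact hxa ▸ haA
      have hpW : p x ∉ W := by
        by_cases hpx : p x = a
        · rwa [hpx]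
        · exact fun h => hp.ncard_ne_one hxa hpx ((hleaf _).1 h)
      have := ih _ (hm ▸ hp.lt x hxa) _ rfl hpW
      by_contra hxA
      exact hsep _ this _ hxA hpW hxW (hTG (hp.adj_parent hxa).symm)
  exact hbA (key _ b rfl hbW)

/-- If removing at least `k` vertices from the graph leaves at least as many isolated vertices,
up to one, and something else, then the graph is not `k`-leaf-connected. -/
theorem not_isLeafConnected_of_card_le {V : Type*} [Fintype V] {k : ℕ} {G : SimpleGraph V}
    {W I : Finset V} (hk : 1 ≤ k) (hkW : k ≤ W.card) (hIW : W.card ≤ I.card + 1) 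
    (hI : ∀ x ∈ I, ∀ y, G.Adj x y → y ∈ W) {r : V} (hrW : r ∉ W) (hrI : r ∉ I) :
    ¬ G.IsLeafConnected k := by
  classical
  intro hG
  obtain ⟨S, hSW, hS⟩ := Finset.exists_subset_card_eq hkW
  obtain ⟨T, hTG, hT, hleaf⟩ := hG.2 S hS
  obtain ⟨p, d, hp⟩ := hT.exists_isParentFun r
  have hnl : ∀ x, x ∉ W → (T.neighborSet x).ncard ≠ 1 :=
    fun x hx h => hx (hSW ((hleaf x).2 h))
  obtain ⟨w, hw⟩ := Finset.card_pos.1 (show 0 < W.card by omega)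
  obtain ⟨a, har, hpa⟩ := hp.exists_child_root ⟨w, fun e => hrW (e ▸ hw)⟩
  -- Vertices outside `W` are not leaves, so each has a child, and `r` has one besides `a`; hence
  -- `p` maps `X` onto `Wᶜ`. But `X` and `a` avoid `r` and `I`, as parents of vertices of `I` lie in
  -- `W`. Thus `n - |W| ≤ |X| ≤ n - |I| - 2`, contradicting `hIW`.
  let X : Finset V := Finset.univ.filter fun x => x ≠ r ∧ x ≠ a ∧ p x ∉ W
  have haX : a ∉ X := by simp [X]
  have h1 : Wᶜ ⊆ X.image p := by
    intro y hy
    rw [Finset.mem_compl] at hy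
    rw [Finset.mem_image]
    by_cases hyr : y = r
    · subst hyr
      obtain ⟨x, hx, hxa, hxy⟩ := hp.exists_second_child (hnl _ hy) har hpa
      exact ⟨x, Finset.mem_filter.2 ⟨Finset.mem_univ _, hx, hxa, hxy ▸ hy⟩, hxy⟩
    · obtain ⟨x, hx, hxy⟩ := hp.exists_child hyr (hnl y hy)
      refine ⟨x, Finset.mem_filter.2 ⟨Finset.mem_univ _, hx, ?_, hxy ▸ hy⟩, hxy⟩
      rintro rfl
      exact hyr (hxy.symm.trans hpa)
  have h2 : insert a X ⊆ (insert r I)ᶜ := by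
    intro x hx
    have hx' : x ≠ r ∧ p x ∉ W := by
      rcases Finset.mem_insert.1 hx with rfl | hx
      · exact ⟨har, hpa ▸ hrW⟩
      · have := (Finset.mem_filter.1 hx).2
        exact ⟨this.1, this.2.2⟩
    rw [Finset.mem_compl, Finset.mem_insert, not_or]
    exact ⟨hx'.1, fun h => hx'.2 (hI x h _ (hTG (hp.adj_parent hx'.1)))⟩
  have h3 := (Finset.card_le_card h1).trans Finset.card_image_le
  have h4 := Finset.card_le_card h2
  rw [Finset.card_insert_of_notMem haX, Finset.card_compl, Finset.card_insert_of_notMem hrI] at h4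
  rw [Finset.card_compl] at h3
  have h5 := Finset.card_le_univ W
  have h6 := Finset.card_le_univ (insert r I)
  rw [Finset.card_insert_of_notMem hrI] at h6
  omega

/-! ### Edge counting and the structure of the complement -/

section Counting

variable {V : Type*} [Fintype V] [DecidableEq V] (F : SimpleGraph V) [DecidableRel F.Adj]

theorem degree_eq_card_filter_add (X : Finset V) (x : V) :
    F.degree x = (X.filter (F.Adj x)).card + (Xᶜ.filter (F.Adj x)).card := by
  rw [← card_neighborFinset_eq_degree, neighborFinset_eq_filter, Finset.card_filter,
    Finset.card_filter, Finset.card_filter, Finset.sum_add_sum_compl]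

/-- Edges between `X` and its complement are counted from both sides. -/
theorem two_mul_card_edgeFinset_add (X : Finset V) :
    2 * F.edgeFinset.card + ∑ x ∈ X, (X.filter (F.Adj x)).card =
      2 * ∑ x ∈ X, F.degree x + ∑ x ∈ Xᶜ, (Xᶜ.filter (F.Adj x)).card := by
  have h1 : ∑ x ∈ X, (Xᶜ.filter (F.Adj x)).card = ∑ x ∈ Xᶜ, (X.filter (F.Adj x)).card := by
    simp only [Finset.card_filter]
    rw [Finset.sum_comm]
    simp only [F.adj_comm]
  have h2 : ∀ Y : Finset V, ∑ x ∈ Y, F.degree x =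
      ∑ x ∈ Y, (X.filter (F.Adj x)).card + ∑ x ∈ Y, (Xᶜ.filter (F.Adj x)).card := fun Y => by
    rw [← Finset.sum_add_distrib]
    exact Finset.sum_congr rfl fun x _ => F.degree_eq_card_filter_add X x
  rw [← F.sum_degrees_eq_twice_card_edges, ← Finset.sum_add_sum_compl X, h2 X, h2 Xᶜ, h1]
  ring

theorem two_mul_sum_degree_le (X : Finset V) :
    2 * ∑ x ∈ X, F.degree x ≤ 2 * F.edgeFinset.card + X.card * (X.card - 1) := by
  have h1 := F.two_mul_card_edgeFinset_add X
  have h2 : ∑ x ∈ X, (X.filter (F.Adj x)).card ≤ X.card * (X.card - 1) := by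
    rw [← smul_eq_mul]
    refine Finset.sum_le_card_nsmul _ _ _ fun x hx => ?_
    rw [← Finset.card_erase_of_mem hx]
    refine Finset.card_le_card fun y hy => ?_
    obtain ⟨hyX, hxy⟩ := Finset.mem_filter.1 hy
    exact Finset.mem_erase.2 ⟨hxy.ne', hyX⟩
  omega

end Counting

/-- Here `s` is the least positive degree and `t` the degree sum over a neighbourhood of size `s`.
For `4 ≤ s ≤ 8` the bound `h1` gives `(s - 3) * N ≤ (3 * s * s - s) / 2 - 11`; the tightest case is
`s = 8`, where `5 * N ≤ 81` contradicts `17 ≤ N`. For `s ≥ 9`, either `h2` (if `N ≤ 2 * s`) or `h1`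
(if `N ≥ 2 * s`) leads to `s * s + 22 ≤ 11 * s`, which is false. -/
theorem eq_two_or_eq_three_of_le {N s t e : ℕ} (hN : 17 ≤ N) (hsN : s + 2 ≤ N) (hs : 2 ≤ s)
    (h1 : s * (N - s) ≤ t) (h2 : s * s ≤ t) (h3 : 2 * t ≤ 2 * e + s * (s - 1))
    (h4 : e + 11 ≤ 3 * N) : s = 2 ∨ s = 3 := by
  by_contra hcon
  rcases (show (4 ≤ s ∧ s ≤ 8) ∨ 9 ≤ s by omega) with ⟨h4, h8⟩ | h9
  · interval_cases s <;> omega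
  · obtain ⟨m, rfl⟩ : ∃ m, s = m + 9 := ⟨s - 9, by omega⟩
    obtain ⟨M, rfl⟩ : ∃ M, N = M + (m + 9) := ⟨N - (m + 9), by omega⟩
    rw [Nat.add_sub_cancel] at h1
    rw [show m + 9 - 1 = m + 8 by omega] at h3
    rcases le_total M (m + 9) with hM | hM
    · nlinarith
    · obtain ⟨j, rfl⟩ : ∃ j, M = m + 9 + j := ⟨M - (m + 9), by omega⟩
      nlinarith [Nat.zero_le (m * j)]

theorem adj_iff_of_independent {V : Type*} {F : SimpleGraph V} {X Q : Finset V}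
    (hdisj : Disjoint X Q) (hXQ : ∀ x ∈ X, ∀ y, y ∉ X → (F.Adj x y ↔ y ∈ Q))
    (hY : ∀ a b, a ∉ X → b ∉ X → ¬ F.Adj a b) (hX : ∀ x ∈ X, ∀ y ∈ X, ¬ F.Adj x y) (a b : V) :
    F.Adj a b ↔ (a ∈ X ∧ b ∈ Q) ∨ (b ∈ X ∧ a ∈ Q) := by
  by_cases ha : a ∈ X <;> by_cases hb : b ∈ X
  · simp [hX a ha b hb, Finset.disjoint_left.1 hdisj ha, Finset.disjoint_left.1 hdisj hb]
  · simp [hXQ a ha b hb, ha, hb]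
  · simp [F.adj_comm a b, hXQ b hb a ha, ha, hb]
  · simp [hY a b ha hb, ha, hb]

theorem adj_iff_of_clique {V : Type*} {F : SimpleGraph V} {X Q : Finset V}
    (hXQ : ∀ x ∈ X, ∀ y, y ∉ X → (F.Adj x y ↔ y ∈ Q))
    (hY : ∀ a b, a ∉ X → b ∉ X → ¬ F.Adj a b) (hX : ∀ x ∈ X, ∀ y ∈ X, x ≠ y → F.Adj x y)
    (a b : V) :
    F.Adj a b ↔ a ≠ b ∧ ((a ∈ X ∧ (b ∈ X ∨ b ∈ Q)) ∨ (b ∈ X ∧ a ∈ Q)) := by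
  by_cases ha : a ∈ X <;> by_cases hb : b ∈ X
  · have : F.Adj a b ↔ a ≠ b := ⟨Adj.ne, hX a ha b hb⟩
    simp [this, ha, hb]
  · have h3 : a ≠ b := fun e => hb (e ▸ ha)
    simp [hXQ a ha b hb, ha, hb, h3]
  · have h3 : a ≠ b := fun e => ha (e ▸ hb)
    simp [F.adj_comm a b, hXQ b hb a ha, ha, hb, h3]
  · simp [hY a b ha hb, ha, hb]

/-- If every edge of `F` has degree sum at least `N`, every degree is at most `N - 2` and there
are at most `3 * N - 11` edges, then, up to isolated vertices, `F` is empty or one of the three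
graphs `K_{2,N-2}`, `K₂ ∨ (N-3)K₁` and `K₃ ∨ (N-5)K₁`. -/
theorem eq_bot_or_exists_of_degree_add_degree {V : Type*} [Fintype V] [DecidableEq V]
    (F : SimpleGraph V) [DecidableRel F.Adj] {N : ℕ} (hN : 17 ≤ N)
    (hdeg : ∀ v, F.degree v + 2 ≤ N) (hadj : ∀ u v, F.Adj u v → N ≤ F.degree u + F.degree v)
    (hcard : F.edgeFinset.card + 11 ≤ 3 * N) :
    F = ⊥ ∨ ∃ X Q : Finset V, Disjoint X Q ∧
      ((X.card = 2 ∧ Q.card + 2 = N ∧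
          ∀ a b, F.Adj a b ↔ (a ∈ X ∧ b ∈ Q) ∨ (b ∈ X ∧ a ∈ Q)) ∨
        ((X.card = 2 ∧ Q.card + 3 = N ∨ X.card = 3 ∧ Q.card + 5 = N) ∧
          ∀ a b, F.Adj a b ↔ a ≠ b ∧ ((a ∈ X ∧ (b ∈ X ∨ b ∈ Q)) ∨ (b ∈ X ∧ a ∈ Q)))) := by
  by_cases hbot : F = ⊥
  · exact Or.inl hbot
  right
  obtain ⟨a₀, b₀, hab₀⟩ := ne_bot_iff_exists_adj.1 hbot
  -- The set `X` will be the neighbourhood of a vertex `v` of least positive degree `s`. Its members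
  -- have degree at least `N - s` and at least `s`, too much for the edge bound unless `s` is 2 or
  -- 3.
  have hpos : ∀ {a b}, F.Adj a b → 0 < F.degree a := fun {a b} h =>
    (F.degree_pos_iff_exists_adj a).2 ⟨b, h⟩
  obtain ⟨v, hv, hmin⟩ := Finset.exists_min_image (Finset.univ.filter fun v => 0 < F.degree v)
    (fun v => F.degree v) ⟨a₀, by simpa using hpos hab₀⟩
  replace hv : 0 < F.degree v := by simpa using hv
  replace hmin : ∀ x, 0 < F.degree x → F.degree v ≤ F.degree x := fun x hx => hmin x (by simpa)
  set s := F.degree v with hs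
  set X := F.neighborFinset v with hX
  have hXs : X.card = s := F.card_neighborFinset_eq_degree v
  have hX1 : ∀ x ∈ X, N ≤ s + F.degree x := fun x hx => hadj v x (by simpa [hX] using hx)
  have hX2 : ∀ x ∈ X, s ≤ F.degree x := fun x hx => by
    have : F.Adj v x := by simpa [hX] using hx
    exact hmin x (hpos this.symm)
  have hsum1 : s * (N - s) ≤ ∑ x ∈ X, F.degree x := by
    rw [← hXs, ← smul_eq_mul, hXs]
    have := Finset.card_nsmul_le_sum X (fun x => F.degree x) (N - s) fun x hx => by have := hX1 x hx; omega
    rwa [hXs] at this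
  have hsum2 : s * s ≤ ∑ x ∈ X, F.degree x := by
    have := Finset.card_nsmul_le_sum X (fun x => F.degree x) s hX2
    rwa [hXs, smul_eq_mul] at this
  have hle := F.two_mul_sum_degree_le X
  rw [hXs] at hle
  have hsN : s + 2 ≤ N := hdeg v
  have hs23 : s = 2 ∨ s = 3 := by
    refine eq_two_or_eq_three_of_le hN hsN ?_ hsum1 hsum2 hle hcard
    obtain ⟨x, hx⟩ := Finset.card_pos.1 (hXs ▸ hv)
    have := hX1 x hx
    have := hdeg x
    omega
  -- An edge outside `X` would add at least `N` to the degree sum over `X`, again exceeding the edge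
  -- bound; for `s = 2` this reads `6 * N - 8 ≤ 6 * N - 10`.
  have hYind : ∀ a b, a ∉ X → b ∉ X → ¬ F.Adj a b := by
    intro a b ha hb hab
    have h1 := F.two_mul_sum_degree_le (insert a (insert b X))
    have haX : a ∉ insert b X := by simp [hab.ne, ha]
    rw [Finset.card_insert_of_notMem haX, Finset.card_insert_of_notMem hb,
      Finset.sum_insert haX, Finset.sum_insert hb, hXs] at h1
    have h2 := hadj a b hab
    rcases hs23 with h | h <;> rw [h] at h1 hsum1 <;> omega
  -- All neighbours of `y` lie in `X`, and by minimality there are at least `s = X.card` of them.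
  have hYX : ∀ y, y ∉ X → 0 < F.degree y → ∀ x ∈ X, F.Adj y x := by
    intro y hy hd
    have h1 : F.neighborFinset y ⊆ X := by
      intro x hx
      by_contra hxX
      exact hYind y x hy hxX (by simpa using hx)
    have h2 := Finset.eq_of_subset_of_card_le h1 (by
      rw [hXs, F.card_neighborFinset_eq_degree]; exact hmin y hd)
    intro x hx
    rw [← h2] at hx
    simpa using hx
  let Q : Finset V := Finset.univ.filter fun y => y ∉ X ∧ 0 < F.degree y
  have hQ : ∀ y, y ∈ Q ↔ y ∉ X ∧ 0 < F.degree y := fun y => by simp [Q]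
  have hXQ : ∀ x ∈ X, ∀ y, y ∉ X → (F.Adj x y ↔ y ∈ Q) := by
    intro x hx y hy
    rw [hQ]
    exact ⟨fun h => ⟨hy, hpos h.symm⟩, fun h => (hYX y hy h.2 x hx).symm⟩
  have hdX : ∀ x ∈ X, F.degree x = (X.filter (F.Adj x)).card + Q.card := by
    intro x hx
    rw [F.degree_eq_card_filter_add X x]
    congr 2
    ext y
    rw [Finset.mem_filter, Finset.mem_compl]
    constructor
    · rintro ⟨h1, h2⟩
      exact (hXQ x hx y h1).1 h2
    · intro h
      have h1 := ((hQ y).1 h).1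
      exact ⟨h1, (hXQ x hx y h1).2 h⟩
  have hYY : ∑ x ∈ Xᶜ, (Xᶜ.filter (F.Adj x)).card = 0 := by
    refine Finset.sum_eq_zero fun x hx => ?_
    rw [Finset.card_eq_zero, Finset.filter_eq_empty_iff]
    intro y hy
    rw [Finset.mem_compl] at hx hy
    exact hYind x y hx hy
  have hid := F.two_mul_card_edgeFinset_add X
  rw [hYY] at hid
  have hdisj : Disjoint X Q := Finset.disjoint_left.2 fun x h1 h2 => ((hQ x).1 h2).1 h1
  refine ⟨X, Q, hdisj, ?_⟩
  have hindep := adj_iff_of_independent hdisj hXQ hYind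
  have hcliq := adj_iff_of_clique hXQ hYind
  clear_value X s
  rcases hs23 with h | h
  · subst h
    obtain ⟨x, y, hxy, rfl⟩ := Finset.card_eq_two.1 hXs
    have hx := hdX x (by simp)
    have hx1 := hX1 x (by simp)
    have hx2 := hdeg x
    by_cases hAdj : F.Adj x y
    · refine Or.inr ⟨Or.inl ⟨hXs, ?_⟩, hcliq ?_⟩
      · simp [Finset.filter_insert, Finset.filter_singleton, hAdj] at hx
        omega
      · simp [hAdj, hAdj.symm]
    · refine Or.inl ⟨hXs, ?_, hindep ?_⟩
      · simp [Finset.filter_insert, Finset.filter_singleton, hAdj] at hx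
        omega
      · simp [hAdj, F.adj_comm y x]
  · subst h
    obtain ⟨x, y, z, hxy, hxz, hyz, rfl⟩ := Finset.card_eq_three.1 hXs
    have hx := hdX x (by simp)
    have hx1 := hX1 x (by simp)
    have hy := hdX y (by simp)
    have hy1 := hX1 y (by simp)
    have hz := hdX z (by simp)
    have hz1 := hX1 z (by simp)
    rw [Finset.sum_insert (by simp [hxy, hxz]), Finset.sum_pair hyz,
      Finset.sum_insert (by simp [hxy, hxz]), Finset.sum_pair hyz] at hid
    -- With `m` edges inside `X`, `F` has `m + 3 * Q.card` edges. A missing edge inside `X` forces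
    -- `Q.card ≥ N - 4`, and even `N - 3` if `m ≤ 1`, so more than `3 * N - 11` edges; hence `m =
    -- 3`, and then `Q.card = N - 5`.
    have hnum : F.Adj x y ∧ F.Adj x z ∧ F.Adj y z ∧ Q.card + 5 = N := by
      by_cases h1 : F.Adj x y <;> by_cases h2 : F.Adj x z <;> by_cases h3 : F.Adj y z <;>
      simp [Finset.filter_insert, Finset.filter_singleton, h1, h2, h3, F.adj_comm y x,
        F.adj_comm z x, F.adj_comm z y, hxy, hxz, hyz] at hx hy hz hid ⊢ <;> omega
    obtain ⟨h1, h2, h3, h4⟩ := hnum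
    refine Or.inr ⟨Or.inr ⟨hXs, h4⟩, hcliq ?_⟩
    simp [h1, h2, h3, h1.symm, h2.symm, h3.symm]

/-! ### Recognising the exceptional joins -/

/-- The form of `hI`, independent of any labelling of `I`, suffices because it is used for `M`
complete or edgeless. -/
theorem nonempty_iso_graphJoin {V : Type*} [Fintype V] {H : SimpleGraph V} {w c i : ℕ}
    {M : SimpleGraph (Fin i)} {W C I : Finset V} (hw : W.card = w) (hc : C.card = c)
    (hi : I.card = i) (hcard : w + c + i = Fintype.card V)
    (hWC : Disjoint W C) (hWI : Disjoint W I) (hCI : Disjoint C I)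
    (hW : ∀ a ∈ W, ∀ b, b ≠ a → H.Adj a b) (hC : ∀ a ∈ C, ∀ b ∈ C, a ≠ b → H.Adj a b)
    (hCI' : ∀ a ∈ C, ∀ b ∈ I, ¬ H.Adj a b)
    (hI : ∀ a ∈ I, ∀ b ∈ I, ∀ x y, x ≠ y → a ≠ b → (H.Adj a b ↔ M.Adj x y)) :
    Nonempty (H ≃g (completeGraph (Fin w)).graphJoin (completeGraph (Fin c) ⊕g M)) := by
  let fw := (W.equivFinOfCardEq hw).symm
  let fc := (C.equivFinOfCardEq hc).symm
  let fi := (I.equivFinOfCardEq hi).symm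
  let f : Fin w ⊕ (Fin c ⊕ Fin i) → V :=
    Sum.elim (fun x => (fw x : V)) (Sum.elim (fun x => (fc x : V)) (fun x => (fi x : V)))
  have nWC : ∀ x y, (fw x : V) ≠ fc y := fun x y => hWC.forall_ne_finset (fw x).2 (fc y).2
  have nWI : ∀ x y, (fw x : V) ≠ fi y := fun x y => hWI.forall_ne_finset (fw x).2 (fi y).2
  have nCI : ∀ x y, (fc x : V) ≠ fi y := fun x y => hCI.forall_ne_finset (fc x).2 (fi y).2
  have injw : ∀ x y, (fw x : V) = fw y ↔ x = y := fun x y => by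
    rw [Subtype.coe_inj, fw.injective.eq_iff]
  have injc : ∀ x y, (fc x : V) = fc y ↔ x = y := fun x y => by
    rw [Subtype.coe_inj, fc.injective.eq_iff]
  have inji : ∀ x y, (fi x : V) = fi y ↔ x = y := fun x y => by
    rw [Subtype.coe_inj, fi.injective.eq_iff]
  have hf : Function.Bijective f := by
    rw [Fintype.bijective_iff_injective_and_card]
    refine ⟨?_, by simp [← hcard, add_assoc]⟩
    rintro (x | x | x) (y | y | y) h
    · exact congrArg _ ((injw x y).1 h)
    · exact absurd h (nWC x y)
    · exact absurd h (nWI x y)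
    · exact absurd h.symm (nWC y x)
    · exact congrArg _ (congrArg _ ((injc x y).1 h))
    · exact absurd h (nCI x y)
    · exact absurd h.symm (nWI y x)
    · exact absurd h.symm (nCI y x)
    · exact congrArg _ (congrArg _ ((inji x y).1 h))
  refine ⟨RelIso.symm ⟨Equiv.ofBijective f hf, ?_⟩⟩
  rintro (x | x | x) (y | y | y)
  · have : H.Adj (fw x) (fw y) ↔ x ≠ y :=
      ⟨fun h e => h.ne ((injw x y).2 e),
        fun h => hW _ (fw x).2 _ (fun e => h ((injw _ _).1 e).symm)⟩
    simpa [graphJoin, f] using this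
  · simpa [graphJoin, f] using hW _ (fw x).2 _ (nWC x y).symm
  · simpa [graphJoin, f] using hW _ (fw x).2 _ (nWI x y).symm
  · simpa [graphJoin, f] using (hW _ (fw y).2 _ (nWC y x).symm).symm
  · have : H.Adj (fc x) (fc y) ↔ x ≠ y :=
      ⟨fun h e => h.ne ((injc x y).2 e),
        fun h => hC _ (fc x).2 _ (fc y).2 (fun e => h ((injc _ _).1 e))⟩
    simpa [graphJoin, f] using this
  · simpa [graphJoin, f] using hCI' _ (fc x).2 _ (fi y).2
  · simpa [graphJoin, f] using (hW _ (fw y).2 _ (nWI y x).symm).symm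
  · simpa [graphJoin, f] using fun h : H.Adj (fi x) (fc y) => hCI' _ (fc y).2 _ (fi x).2 h.symm
  · have : H.Adj (fi x) (fi y) ↔ M.Adj x y := by
      by_cases h : x = y
      · subst h; simp
      · exact hI _ (fi x).2 _ (fi y).2 x y h (fun e => h ((inji x y).1 e))
    simpa [graphJoin, f] using this

theorem exists_partition_of_iso_graphJoin {V : Type*} [Fintype V] {H : SimpleGraph V} {w c i : ℕ}
    {M : SimpleGraph (Fin i)}
    (e : H ≃g (completeGraph (Fin w)).graphJoin (completeGraph (Fin c) ⊕g M)) :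
    ∃ W C I : Finset V, W.card = w ∧ C.card = c ∧ I.card = i ∧ Disjoint W C ∧ Disjoint W I ∧
      Disjoint C I ∧ (∀ x, x ∈ W ∨ x ∈ C ∨ x ∈ I) ∧ (∀ a ∈ C, ∀ b ∈ I, ¬ H.Adj a b) ∧
      (M = ⊥ → ∀ a ∈ I, ∀ b ∈ I, ¬ H.Adj a b) := by
  classical
  have hinj := e.symm.injective
  have hadj : ∀ a b, H.Adj (e.symm a) (e.symm b) ↔ _ := fun a b => e.symm.map_adj_iff
  refine ⟨Finset.univ.image fun x => e.symm (Sum.inl x),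
    Finset.univ.image fun x => e.symm (Sum.inr (Sum.inl x)),
    Finset.univ.image fun x => e.symm (Sum.inr (Sum.inr x)), ?_, ?_, ?_, ?_, ?_, ?_, ?_, ?_, ?_⟩
  · rw [Finset.card_image_of_injective _ fun x y h => by simpa using h, Finset.card_fin]
  · rw [Finset.card_image_of_injective _ fun x y h => by simpa using h, Finset.card_fin]
  · rw [Finset.card_image_of_injective _ fun x y h => by simpa using h, Finset.card_fin]
  · simp [Finset.disjoint_left]
  · simp [Finset.disjoint_left]
  · simp [Finset.disjoint_left]
  · intro x
    rcases h : e x with y | y | y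
    · exact Or.inl (Finset.mem_image.2 ⟨y, Finset.mem_univ _, by rw [← h]; exact e.symm_apply_apply x⟩)
    · exact Or.inr (Or.inl
        (Finset.mem_image.2 ⟨y, Finset.mem_univ _, by rw [← h]; exact e.symm_apply_apply x⟩))
    · exact Or.inr (Or.inr
        (Finset.mem_image.2 ⟨y, Finset.mem_univ _, by rw [← h]; exact e.symm_apply_apply x⟩))
  · intro a ha b hb
    obtain ⟨x, -, rfl⟩ := Finset.mem_image.1 ha
    obtain ⟨y, -, rfl⟩ := Finset.mem_image.1 hb
    rw [hadj]
    simp [graphJoin]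
  · rintro rfl a ha b hb
    obtain ⟨x, -, rfl⟩ := Finset.mem_image.1 ha
    obtain ⟨y, -, rfl⟩ := Finset.mem_image.1 hb
    rw [hadj]
    simp [graphJoin]

/-- The exceptional graphs with an independent set of vertices of small degree. -/
theorem not_isLeafConnected_of_iso_emptyGraph {V : Type*} [Fintype V] {G H : SimpleGraph V}
    [DecidableRel G.Adj] (hGH : G ≤ H) {k c i : ℕ} (hk : 1 ≤ k) (hdeg : k + 1 ≤ G.minDegree)
    (hc : 0 < c) (hi : 0 < i)
    (e : H ≃g (completeGraph (Fin (i + 1))).graphJoin (completeGraph (Fin c) ⊕g emptyGraph (Fin i))) :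
    ¬ H.IsLeafConnected k := by
  classical
  obtain ⟨W, C, I, hW, hC, hI, hWC, hWI, hCI, hcov, hnCI, hnI⟩ :=
    exists_partition_of_iso_graphJoin e
  have hIW : ∀ x ∈ I, ∀ y, H.Adj x y → y ∈ W := by
    intro x hx y hxy
    rcases hcov y with h | h | h
    · exact h
    · exact absurd hxy.symm (hnCI y h x hx)
    · exact absurd hxy (hnI rfl x hx y h)
  obtain ⟨r, hr⟩ := Finset.card_pos.1 (hC ▸ hc)
  obtain ⟨x, hx⟩ := Finset.card_pos.1 (hI ▸ hi)
  -- Vertices of `I` have all their neighbours in `W`, so the minimum degree forces `k + 1 ≤ i + 1`.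
  -- This provides `k ≤ W.card` without fixing `k`.
  have h1 : G.degree x ≤ W.card := by
    rw [← card_neighborFinset_eq_degree]
    exact Finset.card_le_card fun y hy => hIW x hx y (hGH (by simpa using hy))
  have h2 := G.minDegree_le_degree x
  exact not_isLeafConnected_of_card_le hk (by omega) (by omega) hIW
    (Finset.disjoint_right.1 hWC hr) (Finset.disjoint_left.1 hCI hr)

/-- The exceptional graph with a separating set of `k` vertices. -/
theorem not_isLeafConnected_of_iso_completeGraph {V : Type*} [Fintype V] {H : SimpleGraph V}
    {k c i : ℕ} (hc : 0 < c) (hi : 0 < i)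
    (e : H ≃g (completeGraph (Fin k)).graphJoin (completeGraph (Fin c) ⊕g completeGraph (Fin i))) :
    ¬ H.IsLeafConnected k := by
  obtain ⟨W, C, I, hW, hC, hI, hWC, hWI, hCI, hcov, hnCI, -⟩ :=
    exists_partition_of_iso_graphJoin e
  obtain ⟨a, ha⟩ := Finset.card_pos.1 (hC ▸ hc)
  obtain ⟨b, hb⟩ := Finset.card_pos.1 (hI ▸ hi)
  refine not_isLeafConnected_of_separating hW (Finset.disjoint_right.1 hWC ha) ha
    (Finset.disjoint_right.1 hWI hb) (Finset.disjoint_right.1 hCI hb) fun x hx y hy _ hyW => ?_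
  have := hcov y
  exact hnCI x hx y (by tauto)

/-! ### From the closed graph to its complement, and the theorem -/

open Classical in
theorem degree_add_degree_compl {V : Type*} [Fintype V] (H : SimpleGraph V) (v : V) :
    H.degree v + Hᶜ.degree v + 1 = Fintype.card V := by
  have h1 := H.degree_lt_card_verts v
  have h2 := H.degree_compl v
  omega

open Classical in
theorem two_mul_card_edgeFinset_add_compl {V : Type*} [Fintype V] (H : SimpleGraph V) :
    2 * H.edgeFinset.card + 2 * Hᶜ.edgeFinset.card = Fintype.card V * (Fintype.card V - 1) := by
  rw [← sum_degrees_eq_twice_card_edges, ← sum_degrees_eq_twice_card_edges,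
    ← Finset.sum_add_distrib, ← smul_eq_mul, ← Finset.card_univ, ← Finset.sum_const]
  refine Finset.sum_congr rfl fun v _ => ?_
  have := H.degree_add_degree_compl v
  rw [Finset.card_univ]
  omega

-- This is `eq_bot_or_exists_of_degree_add_degree` for the complement with `N = n - k`: closedness
-- gives the degree sums, the minimum degree the bound `N - 2`, and the size the bound `3 * N - 11`.
open Classical in
theorem compl_eq_bot_or_exists {V : Type*} [Fintype V] {G H : SimpleGraph V} {n k : ℕ}
    (hcard : Fintype.card V = n) (hn : k + 17 ≤ n) (hGH : G ≤ H)
    (hdeg : k + 1 ≤ G.minDegree)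
    (hsize : (n - 3).choose 2 + 3 * k + 5 ≤ G.edgeFinset.card)
    (hclosed : ∀ K, ¬ JoinStep (n + k - 1) H K) :
    Hᶜ = ⊥ ∨ ∃ X Q : Finset V, Disjoint X Q ∧
      ((X.card = 2 ∧ Q.card + 2 = n - k ∧
          ∀ a b, Hᶜ.Adj a b ↔ (a ∈ X ∧ b ∈ Q) ∨ (b ∈ X ∧ a ∈ Q)) ∨
        ((X.card = 2 ∧ Q.card + 3 = n - k ∨ X.card = 3 ∧ Q.card + 5 = n - k) ∧
          ∀ a b, Hᶜ.Adj a b ↔ a ≠ b ∧ ((a ∈ X ∧ (b ∈ X ∨ b ∈ Q)) ∨ (b ∈ X ∧ a ∈ Q)))) := by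
  have hH : ∀ v, k + 1 ≤ H.degree v := fun v =>
    hdeg.trans ((G.minDegree_le_degree v).trans (degree_le_of_le hGH))
  refine eq_bot_or_exists_of_degree_add_degree _ (by omega) (fun v => ?_) (fun u v huv => ?_) ?_
  · have := H.degree_add_degree_compl v
    have := hH v
    omega
  · have h1 := H.degree_add_degree_compl u
    have h2 := H.degree_add_degree_compl v
    rw [compl_adj] at huv
    by_contra hlt
    exact hclosed _ ⟨u, v, huv.1, huv.2, by omega, rfl⟩
  · have h1 := H.two_mul_card_edgeFinset_add_compl
    have h2 : G.edgeFinset.card ≤ H.edgeFinset.card :=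
      Finset.card_le_card (edgeFinset_mono hGH)
    have h3 := Nat.choose_succ_right_eq (n - 3) 1
    rw [Nat.choose_one_right] at h3
    rw [hcard] at h1
    -- In terms of `m` and the product `(m + 1) * m`, both binomial coefficients are linear.
    obtain ⟨m, rfl⟩ : ∃ m, n = m + 4 := ⟨n - 4, by omega⟩
    have e1 : m + 4 - 3 = m + 1 := by omega
    have e2 : m + 4 - 1 = m + 3 := by omega
    rw [e1] at h3 hsize
    rw [e2] at h1
    rw [Nat.add_sub_cancel] at h3
    have h4 : (m + 4) * (m + 3) = (m + 1) * m + 6 * m + 12 := by ring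
    rw [h4] at h1
    change (m + 1).choose 2 * 2 = _ at h3
    generalize (m + 1) * m = q at *
    omega

end SimpleGraph

open SimpleGraph in
theorem theorem1p4 {V : Type*} [Fintype V] (G : SimpleGraph V) [DecidableRel G.Adj] (n k : ℕ)
    (hcard : Fintype.card V = n) (hk : 2 ≤ k) (hn : k + 17 ≤ n)
    (hconn : G.Connected) (hdeg : k + 1 ≤ G.minDegree)
    (hsize : (n - 3).choose 2 + 3 * k + 5 ≤ G.edgeFinset.card) :
    G.IsLeafConnected k ↔
      ¬ (Nonempty (G.degreeClosure (n + k - 1) ≃g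
            (SimpleGraph.completeGraph (Fin k)).graphJoin
              (SimpleGraph.completeGraph (Fin (n - k - 2)) ⊕g SimpleGraph.completeGraph (Fin 2))) ∨
          Nonempty (G.degreeClosure (n + k - 1) ≃g
            (SimpleGraph.completeGraph (Fin 3)).graphJoin
              (SimpleGraph.completeGraph (Fin (n - 5)) ⊕g SimpleGraph.emptyGraph (Fin 2))) ∨
          Nonempty (G.degreeClosure (n + k - 1) ≃g
            (SimpleGraph.completeGraph (Fin 4)).graphJoin
              (SimpleGraph.completeGraph (Fin (n - 7)) ⊕g SimpleGraph.emptyGraph (Fin 3)))) := by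
  classical
  have hspec := degreeClosure_spec (n + k - 1) G
  have hGH := reflTransGen_joinStep_ge hspec.1
  have hiff : (G.degreeClosure (n + k - 1)).IsLeafConnected k ↔ G.IsLeafConnected k := by
    rw [← hcard]
    exact isLeafConnected_degreeClosure_iff
  rw [← hiff]
  have hclosed := hspec.2
  clear hspec hiff
  generalize G.degreeClosure (n + k - 1) = H at *
  constructor
  · rintro hlc (⟨⟨e⟩⟩ | ⟨⟨e⟩⟩ | ⟨⟨e⟩⟩)
    · exact not_isLeafConnected_of_iso_completeGraph (by omega) (by omega) e hlc
    · exact not_isLeafConnected_of_iso_emptyGraph hGH (by omega) hdeg (by omega) (by omega) e hlc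
    · exact not_isLeafConnected_of_iso_emptyGraph hGH (by omega) hdeg (by omega) (by omega) e hlc
  · intro hex
    push Not at hex
    obtain ⟨hex1, hex2, hex3⟩ := hex
    have hadjH : ∀ a b, H.Adj a b ↔ a ≠ b ∧ ¬ Hᶜ.Adj a b := fun a b => by
      rw [compl_adj]
      have : H.Adj a b → a ≠ b := Adj.ne
      tauto
    rcases compl_eq_bot_or_exists hcard hn hGH (by convert hdeg) (by convert hsize) hclosed with
      hbot | ⟨X, Q, hXQ, h⟩
    · have hall : ∀ a b, a ≠ b → H.Adj a b := fun a b hab => by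
        rw [hadjH, hbot]; simp [hab]
      refine isLeafConnected_of_card_le hk (W := Finset.univ) (I := ∅) (by simp)
        (fun a b _ _ => hall a b) (fun w _ x hx => hall w x hx.symm) ?_ ?_ <;>
      simp only [Finset.card_univ, Finset.card_empty] <;> omega
    have hWcard : (X ∪ Q)ᶜ.card + X.card + Q.card = n := by
      rw [← hcard, ← Finset.card_compl_add_card (X ∪ Q), Finset.card_union_of_disjoint hXQ, add_assoc]
    have hWX : Disjoint (X ∪ Q)ᶜ X := by simp [Finset.disjoint_left]; tauto
    have hWQ : Disjoint (X ∪ Q)ᶜ Q := by simp [Finset.disjoint_left]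
    have hXQ' := Finset.disjoint_left.1 hXQ
    have hQX' := Finset.disjoint_right.1 hXQ
    rcases h with ⟨hX, hQ, h⟩ | ⟨hc, h⟩
    -- The complement is complete bipartite between `X` and `Q`, so both are cliques of `H`, and `n
    -- - (n - k) = k` universal vertices remain.
    · refine absurd (nonempty_iso_graphJoin ?_ ?_ hX ?_ hWQ hWX hXQ.symm ?_ ?_ ?_ ?_)
        (not_nonempty_iff.2 hex1)
      · omega
      · omega
      · omega
      · intro w hw x hx
        rw [Finset.mem_compl, Finset.mem_union, not_or] at hw
        rw [hadjH, h]
        tauto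
      · intro a ha b hb hab
        rw [hadjH, h]
        have := hQX' ha
        have := hQX' hb
        tauto
      · intro a ha b hb
        rw [hadjH, h]
        tauto
      · intro a ha b hb x y hxy hab
        rw [hadjH, h]
        have := hXQ' ha
        have := hXQ' hb
        simp only [completeGraph_eq_top, top_adj]
        tauto
    · have hW : ∀ w ∈ (X ∪ Q)ᶜ, ∀ x, x ≠ w → H.Adj w x := by
        intro w hw x hx
        rw [Finset.mem_compl, Finset.mem_union, not_or] at hw
        rw [hadjH, h]
        tauto
      have hclique : ∀ a b, a ∉ X → b ∉ X → a ≠ b → H.Adj a b := by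
        intro a b ha hb hab
        rw [hadjH, h]
        tauto
      -- There are `k + 1` universal vertices if `X.card = 2` and `k + 2` if `X.card = 3`; the
      -- required `X.card + 2` is reached exactly when `k ≥ 3`.
      by_cases hk2 : k = 2
      swap
      · refine isLeafConnected_of_card_le hk hWX hclique hW ?_ ?_ <;> omega
      subst hk2
      have hQQ : ∀ a ∈ Q, ∀ b ∈ Q, a ≠ b → H.Adj a b := fun a ha b hb =>
        hclique a b (hQX' ha) (hQX' hb)
      have hQX : ∀ a ∈ Q, ∀ b ∈ X, ¬ H.Adj a b := fun a ha b hb => by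
        rw [hadjH, h]; tauto
      have hXX : ∀ a ∈ X, ∀ b ∈ X, ¬ H.Adj a b := fun a ha b hb => by
        rw [hadjH, h]; tauto
      rcases hc with ⟨hX, hQ⟩ | ⟨hX, hQ⟩
      · refine absurd (nonempty_iso_graphJoin ?_ ?_ hX ?_ hWQ hWX hXQ.symm hW hQQ hQX ?_)
          (not_nonempty_iff.2 hex2)
        · omega
        · omega
        · omega
        · intro a ha b hb x y _ _
          simp [hXX a ha b hb]
      · refine absurd (nonempty_iso_graphJoin ?_ ?_ hX ?_ hWQ hWX hXQ.symm hW hQQ hQX ?_)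
          (not_nonempty_iff.2 hex3)
        · omega
        · omega
        · omega
        · intro a ha b hb x y _ _
          simp [hXX a ha b hb]
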